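/- Let $n \ge 1$, let $0 < p, q \le \infty$, and let $\alpha, s \ge 0$ be real. For a Schwartz function $G_0 : \mathbb R^n \times \mathbb R^n \times \mathbb R^n \to \mathbb C$ let $$G(t,x,y,z) = \left(e^{\frac{it(\Delta_x+\Delta_y-\Delta_z)}{2}} G_0\right)(x,y,z), \qquad t \in \mathbb R,\ x, y, z \in \mathbb R^n,$$ be the solution of the linear equation $i\partial_t G + \tfrac12(\Delta_x+\Delta_y-\Delta_z)G = 0$ with $G(0,\cdot) = G_0$, that is, the function obtained by multiplying the Fourier transform of $G_0$ at the (angular) frequency $(\xi,\eta,\zeta)$ by $e^{-it(|\xi|^2+|\eta|^2-|\zeta|^2)/2}$. Let $|\nabla|_x^{\alpha}$ be the Fourier multiplier on $\mathbb R^n$ with symbol $|\xi|^\alpha$, let $\|\cdot\|_{H^s}$ be the inhomogeneous $L^2$ Sobolev norm on $\mathbb R^{3n}$, and let $\|u\|_{L^p(dt)L^q(dx)}$ be the $L^p$ (quasi-)norm over $t \in \mathbb R$ of $\|u(t,\cdot)\|_{L^q(\mathbb R^n)}$. Assume that there is a finite constant $C$ such that, for all Schwartz functions $G_0$, $$\big\|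 |\nabla|_x^{\alpha}\big[G(t,x,x,x)\big] \big\|_{L^p(dt)L^q(dx)} \le C\, \|G_0\|_{H^s(dx\,dy\,dz)} .$$ Then $p \ge 2$ and $q \ge 2$. -/

import Mathlib

open MeasureTheory FourierTransform
open scoped ENNReal NNReal SchwartzMap

noncomputable section

namespace Collapsing

/-- The physical space `ℝⁿ` with its Euclidean norm. -/
abbrev Space (n : ℕ) : Type := EuclideanSpace ℝ (Fin n)

/-- The space of triples `(x, y, z)` of points of `ℝⁿ`, that is `ℝ³ⁿ` with its Euclidean norm;
`X 0`, `X 1`, `X 2` are the components `x`, `y`, `z`. -/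
abbrev Space3 (n : ℕ) : Type := PiLp 2 (fun _ : Fin 3 => Space n)

/-- The diagonal point `(x, x, x)`. -/
def diag {n : ℕ} (x : Space n) : Space3 n := WithLp.toLp 2 (fun _ => x)

/-- The Fourier multiplier `m(D)`, where `D = -i∇`. Mathlib's Fourier transform has the kernel
`exp (-2πi⟨x, ξ⟩)`, so that `D` corresponds to multiplication by `2πξ`. -/
def multiplier {E : Type*} [NormedAddCommGroup E] [InnerProductSpace ℝ E]
    [MeasurableSpace E] [BorelSpace E] [FiniteDimensional ℝ E]
    (m : E → ℂ) (f : E → ℂ) : E → ℂ :=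
  𝓕⁻ (fun ξ : E => m ((2 * Real.pi) • ξ) * 𝓕 f ξ)

/-- The solution `G(t, ·) = exp (it(Δ_x + Δ_y - Δ_z)/2) G₀`: the multiplier with symbol
`exp (-it(|ξ|² + |η|² - |ζ|²)/2)`. -/
def evolution {n : ℕ} (t : ℝ) (G₀ : Space3 n → ℂ) : Space3 n → ℂ :=
  multiplier (fun Ξ : Space3 n =>
    Complex.exp (-(Complex.I * t * ((‖Ξ 0‖ ^ 2 + ‖Ξ 1‖ ^ 2 - ‖Ξ 2‖ ^ 2 : ℝ) : ℂ) / 2))) G₀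

/-- The fractional derivative `|∇|^α` on `ℝⁿ`: the multiplier with symbol `|ξ|^α`. -/
def fracDeriv {n : ℕ} (α : ℝ) (f : Space n → ℂ) : Space n → ℂ :=
  multiplier (fun ξ : Space n => ((‖ξ‖ ^ α : ℝ) : ℂ)) f

/-- The Sobolev norm `‖f‖_{H^s} = ‖(1 + |2πξ|²)^(s/2) f̂‖_{L²}`. -/
def sobolevNorm {E : Type*} [NormedAddCommGroup E] [InnerProductSpace ℝ E]
    [MeasurableSpace E] [BorelSpace E] [FiniteDimensional ℝ E]
    (s : ℝ) (f : E → ℂ) : ℝ≥0∞ :=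
  eLpNorm (fun ξ : E => (((1 + ‖(2 * Real.pi) • ξ‖ ^ 2) ^ (s / 2) : ℝ) : ℂ) * 𝓕 f ξ) 2 volume

/-- The mixed norm `‖u‖_{L^p(dt) L^q(dx)}` over `ℝ × ℝⁿ`, the norm in `x` being taken first. -/
def mixedNorm {n : ℕ} (p q : ℝ≥0∞) (u : ℝ → Space n → ℂ) : ℝ≥0∞ :=
  eLpNorm (fun t : ℝ => eLpNorm (u t) q volume) p volume

/-- The collapsing estimate
`‖|∇|_x^α G(t, x, x, x)‖_{L^p(dt) L^q(dx)} ≤ C ‖G₀‖_{H^s}`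
with a constant `C` that does not depend on the datum `G₀`, for all Schwartz functions `G₀`. -/
def CollapsingEstimate (n : ℕ) (p q : ℝ≥0∞) (α s : ℝ) : Prop :=
  ∃ C : ℝ≥0, ∀ G₀ : 𝓢(Space3 n, ℂ),
    mixedNorm p q (fun t => fracDeriv α (fun x => evolution t G₀ (diag x)))
      ≤ C * sobolevNorm s (G₀ : Space3 n → ℂ)

end Collapsing

end

/-! A space-time translation acts on the Fourier side of the datum as a unimodular factor, so it
preserves the `H^s` norm. Let `r = min p q`, fix a datum whose collapsed solution `V` has `V 0 ≠ 0`,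
and superpose `N` translates with random signs. Averaged over the signs, the squared `H^s` norm is
exactly `N` times that of one datum (`sum_signs_lintegral`), so the right side has size `N^(1/2)`.
On the left, the translates of a small ball around the origin are disjoint, and random signs cannot
cancel the `j`-th term on the `j`-th ball (`enorm_rpow_le_sum_signs`), so the `L^r` norm is at least
of order `N^(1/r)`. Letting `N → ∞` forces `r ≥ 2` (`two_le_of_signSum_bound`).

The translation goes in time if `r = p` and in space if `r = q`. The other variable stays in a
bounded set, where Hölder's inequality lowers its exponent to `r` (`exists_lintegral_le_mixedNorm`).
The datum has compact frequency support away from `ξ + η + ζ = 0`, where `|∇|^α` may fail to have a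
smooth symbol, so the collapsed solution is an explicit oscillatory integral
(`fracDeriv_evolution`). -/

noncomputable section

namespace Collapsing

/-! ### Averages over random signs -/

/-- The linear combination of `v` with the signs `ε`. -/
def signSum {N : ℕ} (ε : Fin N → ℤˣ) (v : Fin N → ℂ) : ℂ := ∑ j, ((ε j : ℤ) : ℂ) * v j

/-- Flipping the `j`-th sign is a bijection that negates every summand. -/
theorem sum_signs_mul {N : ℕ} {j k : Fin N} (h : j ≠ k) :
    ∑ ε : Fin N → ℤˣ, (((ε j : ℤ) : ℝ) * ((ε k : ℤ) : ℝ)) = 0 := by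
  have key : ∑ ε : Fin N → ℤˣ, (((ε j : ℤ) : ℝ) * ((ε k : ℤ) : ℝ))
      = ∑ ε : Fin N → ℤˣ, -(((ε j : ℤ) : ℝ) * ((ε k : ℤ) : ℝ)) := by
    refine Fintype.sum_equiv (Equiv.mulLeft (Pi.mulSingle j (-1 : ℤˣ))) _ _ fun ε => ?_
    simp [h.symm]
  rw [Finset.sum_neg_distrib] at key
  linarith

theorem sum_signs_norm_sq {N : ℕ} (v : Fin N → ℂ) :
    ∑ ε : Fin N → ℤˣ, ‖signSum ε v‖ ^ 2 = 2 ^ N * ∑ j, ‖v j‖ ^ 2 := by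
  have h1 (ε : Fin N → ℤˣ) : ‖signSum ε v‖ ^ 2
      = ∑ j, ∑ k, (((ε j : ℤ) : ℝ) * ((ε k : ℤ) : ℝ)) * (v j * (starRingEnd ℂ) (v k)).re := by
    have h : ((‖signSum ε v‖ ^ 2 : ℝ) : ℂ)
        = ∑ j, ∑ k, ((((ε j : ℤ) : ℝ) * ((ε k : ℤ) : ℝ) : ℝ) : ℂ)
          * (v j * (starRingEnd ℂ) (v k)) := by
      rw [Complex.ofReal_pow, ← Complex.mul_conj', signSum, map_sum, Finset.sum_mul_sum]
      refine Finset.sum_congr rfl fun j _ => Finset.sum_congr rfl fun k _ => ?_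
      simp
      ring
    have h' := congrArg Complex.re h
    simpa only [Complex.ofReal_re, Complex.re_sum, Complex.re_ofReal_mul] using h'
  simp_rw [h1]
  rw [Finset.sum_comm, Finset.mul_sum]
  refine Finset.sum_congr rfl fun j _ => ?_
  rw [Finset.sum_comm, Finset.sum_eq_single j]
  · have (ε : Fin N → ℤˣ) : ((ε j : ℤ) : ℝ) * ((ε j : ℤ) : ℝ) = 1 := by
      rcases Int.units_eq_one_or (ε j) with h | h <;> simp [h]
    simp_rw [this]
    simp only [Complex.mul_conj, Complex.normSq_eq_norm_sq, Complex.ofReal_re]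
    simp
  · intro k _ hk
    rw [← Finset.sum_mul, sum_signs_mul hk.symm, zero_mul]
  · simp

theorem sum_signs_enorm_sq {N : ℕ} (v : Fin N → ℂ) :
    ∑ ε : Fin N → ℤˣ, ‖signSum ε v‖ₑ ^ 2 = 2 ^ N * ∑ j, ‖v j‖ₑ ^ 2 := by
  have h := congrArg ENNReal.ofReal (sum_signs_norm_sq v)
  rw [ENNReal.ofReal_sum_of_nonneg (fun _ _ => by positivity), ENNReal.ofReal_mul (by positivity),
    ENNReal.ofReal_sum_of_nonneg (fun _ _ => by positivity)] at h
  simpa [ENNReal.ofReal_pow, ofReal_norm] using h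

/-- Two signed sums that differ only in the `j`-th sign differ by `± 2 v j`, so one of them has norm
at least `‖v j‖`. -/
theorem enorm_rpow_le_sum_signs {N : ℕ} (v : Fin N → ℂ) (j : Fin N) {r : ℝ} (hr : 0 ≤ r) :
    2 ^ N * ‖v j‖ₑ ^ r ≤ 2 * ∑ ε : Fin N → ℤˣ, ‖signSum ε v‖ₑ ^ r := by
  let δ : Fin N → ℤˣ := Pi.mulSingle j (-1 : ℤˣ)
  have hflip : ∑ ε : Fin N → ℤˣ, ‖signSum (δ * ε) v‖ₑ ^ r = ∑ ε : Fin N → ℤˣ, ‖signSum ε v‖ₑ ^ r :=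
    Fintype.sum_equiv (Equiv.mulLeft δ) _ _ fun ε => rfl
  have hpt (ε : Fin N → ℤˣ) :
      ‖v j‖ₑ ^ r ≤ ‖signSum ε v‖ₑ ^ r + ‖signSum (δ * ε) v‖ₑ ^ r := by
    have hd : signSum ε v - signSum (δ * ε) v = 2 * ((ε j : ℤ) : ℂ) * v j := by
      rw [signSum, signSum, ← Finset.sum_sub_distrib, Finset.sum_eq_single j]
      · simp [δ]; ring
      · intro k _ hk
        simp [δ, hk]
      · simp
    have hn : 2 * ‖v j‖ ≤ ‖signSum ε v‖ + ‖signSum (δ * ε) v‖ := by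
      have := norm_sub_le (signSum ε v) (signSum (δ * ε) v)
      rw [hd] at this
      rcases Int.units_eq_one_or (ε j) with h | h <;> simpa [h] using this
    rcases le_total ‖signSum ε v‖ ‖signSum (δ * ε) v‖ with h | h
    · refine le_add_left (ENNReal.rpow_le_rpow ?_ hr)
      rw [enorm_le_iff_norm_le]; linarith
    · refine le_add_right (ENNReal.rpow_le_rpow ?_ hr)
      rw [enorm_le_iff_norm_le]; linarith
  calc 2 ^ N * ‖v j‖ₑ ^ r = ∑ ε : Fin N → ℤˣ, ‖v j‖ₑ ^ r := by simp
    _ ≤ ∑ ε : Fin N → ℤˣ, (‖signSum ε v‖ₑ ^ r + ‖signSum (δ * ε) v‖ₑ ^ r) :=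
      Finset.sum_le_sum fun ε _ => hpt ε
    _ = 2 * ∑ ε : Fin N → ℤˣ, ‖signSum ε v‖ₑ ^ r := by
      rw [Finset.sum_add_distrib, hflip, two_mul]

/-- Replaces Jensen's inequality in comparing the mean of `R^r` with that of `R^2`: both bases are
at most `x ^ 2 + y`, and the exponents `r / 2` and `1 - r / 2` add up to `1`. -/
theorem rpow_mul_rpow_le_add (x y : ℝ≥0∞) {r : ℝ} (h0 : 0 ≤ r) (h2 : r ≤ 2) :
    x ^ r * y ^ (1 - r / 2) ≤ x ^ 2 + y := by
  have hx : x ^ r = (x ^ 2) ^ (r / 2) := by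
    rw [← ENNReal.rpow_natCast, ← ENNReal.rpow_mul]; congr 1; push_cast; ring
  rw [hx]
  calc (x ^ 2) ^ (r / 2) * y ^ (1 - r / 2)
      ≤ (x ^ 2 + y) ^ (r / 2) * (x ^ 2 + y) ^ (1 - r / 2) :=
        mul_le_mul' (ENNReal.rpow_le_rpow le_self_add (by linarith))
          (ENNReal.rpow_le_rpow le_add_self (by linarith))
    _ = x ^ 2 + y := by
      rw [← ENNReal.rpow_add_of_nonneg _ _ (by linarith) (by linarith)]; simp

/-- If all signed sums of a sequence with mass bounded below on disjoint sets are bounded in `L^r`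
by quantities that are orthogonal on average, then `r ≥ 2`. -/
theorem two_le_of_signSum_bound {D : Type*} [MeasurableSpace D] (μ : Measure D) {r : ℝ}
    (hr : 0 < r) (v : ℕ → D → ℂ) (hv : ∀ j, Measurable (v j)) (S : ℕ → Set D)
    (hS : ∀ j, MeasurableSet (S j)) (hdisj : Pairwise fun i j => Disjoint (S i) (S j))
    {c A K : ℝ≥0∞} (hc : c ≠ 0) (hA : A ≠ ∞) (hK : K ≠ ∞)
    (hlow : ∀ j, c ≤ ∫⁻ z in S j, ‖v j z‖ₑ ^ r ∂μ)
    (R : ∀ N : ℕ, (Fin N → ℤˣ) → ℝ≥0∞)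
    (hR : ∀ N, ∑ ε, R N ε ^ 2 ≤ 2 ^ N * (N * A))
    (hup : ∀ N ε, ∫⁻ z, ‖signSum ε (fun j : Fin N => v j z)‖ₑ ^ r ∂μ ≤ K * R N ε ^ r) :
    2 ≤ r := by
  by_contra! hr2
  have hmeas (N : ℕ) (ε : Fin N → ℤˣ) :
      Measurable fun z => ‖signSum ε (fun j : Fin N => v j z)‖ₑ ^ r := by
    unfold signSum; fun_prop
  have h1 (N : ℕ) : 2 ^ N * (N * c) ≤ 2 * K * ∑ ε, R N ε ^ r := by
    calc (2 : ℝ≥0∞) ^ N * (N * c) = ∑ j : Fin N, 2 ^ N * c := by simp; ring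
      _ ≤ ∑ j : Fin N, ∫⁻ z in S j, 2 * ∑ ε : Fin N → ℤˣ,
          ‖signSum ε (fun j : Fin N => v j z)‖ₑ ^ r ∂μ := by
        refine Finset.sum_le_sum fun j _ => ?_
        refine (mul_le_mul_right (hlow j) _).trans ?_
        rw [← lintegral_const_mul _ (by fun_prop)]
        exact lintegral_mono fun z =>
          enorm_rpow_le_sum_signs (fun j : Fin N => v j z) j hr.le
      _ = ∫⁻ z in ⋃ j : Fin N, S j, 2 * ∑ ε : Fin N → ℤˣ,
          ‖signSum ε (fun j : Fin N => v j z)‖ₑ ^ r ∂μ := by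
        rw [lintegral_iUnion (s := fun j : Fin N => S j) (fun j => hS j)
          (fun i j hij => hdisj (fun h => hij (Fin.ext h))), tsum_fintype]
      _ ≤ ∫⁻ z, 2 * ∑ ε : Fin N → ℤˣ, ‖signSum ε (fun j : Fin N => v j z)‖ₑ ^ r ∂μ :=
        setLIntegral_le_lintegral _ _
      _ = 2 * ∑ ε : Fin N → ℤˣ, ∫⁻ z, ‖signSum ε (fun j : Fin N => v j z)‖ₑ ^ r ∂μ := by
        rw [lintegral_const_mul _ (Finset.measurable_fun_sum _ fun ε _ => hmeas N ε),
          lintegral_finsetSum _ fun ε _ => hmeas N ε]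
      _ ≤ 2 * ∑ ε : Fin N → ℤˣ, K * R N ε ^ r := by
        gcongr with ε
        exact hup N ε
      _ = 2 * K * ∑ ε, R N ε ^ r := by rw [← Finset.mul_sum, mul_assoc]
  -- Taking `y = N` in `rpow_mul_rpow_le_add` makes both resulting terms of order `2 ^ N * N`, which
  -- then cancels.
  have h2 (N : ℕ) (hN : 1 ≤ N) : c * (N : ℝ≥0∞) ^ (1 - r / 2) ≤ 2 * K * (A + 1) := by
    have hpos : (2 : ℝ≥0∞) ^ N * N ≠ 0 := by
      have : N ≠ 0 := by omega
      simp [this]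
    have hfin : (2 : ℝ≥0∞) ^ N * N ≠ ∞ := by finiteness
    rw [← ENNReal.mul_le_mul_iff_right hpos hfin]
    calc (2 : ℝ≥0∞) ^ N * N * (c * (N : ℝ≥0∞) ^ (1 - r / 2))
        = 2 ^ N * (N * c) * (N : ℝ≥0∞) ^ (1 - r / 2) := by ring
      _ ≤ 2 * K * (∑ ε, R N ε ^ r) * (N : ℝ≥0∞) ^ (1 - r / 2) := mul_le_mul_left (h1 N) _
      _ = 2 * K * ∑ ε, R N ε ^ r * (N : ℝ≥0∞) ^ (1 - r / 2) := by
        rw [mul_assoc, Finset.sum_mul]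
      _ ≤ 2 * K * ∑ ε : Fin N → ℤˣ, (R N ε ^ 2 + N) := by
        gcongr with ε
        exact rpow_mul_rpow_le_add _ _ hr.le hr2.le
      _ ≤ 2 * K * (2 ^ N * (N * A) + 2 ^ N * N) := by
        rw [Finset.sum_add_distrib]
        gcongr
        · exact hR N
        · simp
      _ = 2 ^ N * N * (2 * K * (A + 1)) := by ring
  have h3 : Filter.Tendsto (fun N : ℕ => c * (N : ℝ≥0∞) ^ (1 - r / 2)) Filter.atTop
      (nhds ∞) := by
    have h := ENNReal.Tendsto.const_mul (a := c)
      (((ENNReal.continuous_rpow_const (y := 1 - r / 2)).tendsto ∞).comp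
        ENNReal.tendsto_nat_nhds_top) (Or.inl (by simp; linarith))
    rwa [ENNReal.top_rpow_of_pos (by linarith), ENNReal.mul_top hc] at h
  have h4 := le_of_tendsto h3 (Filter.eventually_atTop.2 ⟨1, h2⟩)
  exact absurd (top_le_iff.1 h4) (by finiteness)

/-! ### Fourier multipliers after restriction along a linear map -/

section Transfer

variable {E F : Type*} [NormedAddCommGroup E] [InnerProductSpace ℝ E]

/-- The plane wave `x ↦ exp (2πi⟨x, ξ⟩)`. -/
def wave (x ξ : E) : ℂ := Complex.exp (((2 * Real.pi * inner ℝ x ξ : ℝ) : ℂ) * Complex.I)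

theorem norm_wave (x ξ : E) : ‖wave x ξ‖ = 1 := Complex.norm_exp_ofReal_mul_I _

theorem wave_sub (x y ξ : E) : wave (x - y) ξ = wave x ξ * wave (-y) ξ := by
  simp only [wave, ← Complex.exp_add, ← add_mul, ← Complex.ofReal_add, ← mul_add,
    ← inner_add_left, sub_eq_add_neg]

@[fun_prop]
theorem continuous_wave : Continuous fun p : E × E => wave p.1 p.2 := by
  unfold wave
  fun_prop

variable [MeasurableSpace E] [BorelSpace E] [FiniteDimensional ℝ E]

theorem fourierInv_eq_wave (f : E → ℂ) (x : E) : 𝓕⁻ f x = ∫ ξ, wave x ξ * f ξ := by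
  rw [Real.fourierInv_eq']
  simp only [wave, real_inner_comm, smul_eq_mul]

theorem fourier_eq_wave (f : E → ℂ) (ξ : E) : 𝓕 f ξ = ∫ x, wave (-x) ξ * f x := by
  rw [Real.fourier_eq']
  simp [wave]

variable [NormedAddCommGroup F] [InnerProductSpace ℝ F] [MeasurableSpace F] [BorelSpace F]
  [FiniteDimensional ℝ F]

/-- The inverse Fourier transform of `H` composed with a map `L` to which `T` is dual, convolved
with a Schwartz function. -/
theorem convolution_fourierInv_comp (L : E → F) (T : F → E) (hT : Continuous T)
    (hLT : ∀ x Ξ, inner ℝ (L x) Ξ = inner ℝ x (T Ξ)) (k : 𝓢(E, ℂ)) (H : 𝓢(F, ℂ)) (x : E) :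
    ∫ y, k y * 𝓕⁻ (H : F → ℂ) (L (x - y)) = ∫ Ξ, wave x (T Ξ) * (𝓕 (k : E → ℂ) (T Ξ) * H Ξ) := by
  have hw (z : E) (Ξ : F) : wave (L z) Ξ = wave z (T Ξ) := by simp only [wave, hLT]
  simp_rw [fourierInv_eq_wave, fourier_eq_wave, hw, ← integral_const_mul, ← integral_mul_const,
    ← integral_const_mul]
  -- Fubini applies because the waves have modulus one, which leaves the product of `k` and `H` as
  -- dominating function.
  rw [integral_integral_swap]
  · refine integral_congr_ae (.of_forall fun Ξ => integral_congr_ae (.of_forall fun y => ?_))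
    simp only [wave_sub x y]
    ring
  · have h := (k.integrable (μ := volume)).mul_prod (H.integrable (μ := volume))
    refine h.mono ?_ (.of_forall fun p => ?_)
    · refine Continuous.aestronglyMeasurable ?_
      have hk := k.continuous
      have hH := H.continuous
      have : Continuous fun p : E × F => wave (x - p.1) (T p.2) :=
        continuous_wave.comp (f := fun p : E × F => (x - p.1, T p.2)) (by fun_prop)
      simp only [Function.uncurry_def]
      fun_prop
    · simp [Function.uncurry_def, norm_wave]

/-- A Fourier multiplier applied to `𝓕⁻ H ∘ L` acts on the frequency `T Ξ`, where `T` is dual to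
`L`, if the symbol is smooth on the image of the support of `H`. -/
theorem multiplier_fourierInv_comp (L : E →L[ℝ] F) {K : ℝ≥0} (hL : AntilipschitzWith K L)
    (T : F → E) (hT : Continuous T) (hLT : ∀ x Ξ, inner ℝ (L x) Ξ = inner ℝ x (T Ξ))
    (H : 𝓢(F, ℂ)) (m : E → ℂ) (χ κ : 𝓢(E, ℂ)) (hχ : ∀ Ξ, H Ξ ≠ 0 → χ (T Ξ) = 1)
    (hκ : ∀ ξ, κ ξ = m ((2 * Real.pi) • ξ) * χ ξ) (x : E) :
    multiplier m (fun x => 𝓕⁻ (H : F → ℂ) (L x)) x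
      = ∫ Ξ, wave x (T Ξ) * (m ((2 * Real.pi) • T Ξ) * H Ξ) := by
  let f : 𝓢(E, ℂ) := SchwartzMap.compCLMOfAntilipschitz ℂ L.hasTemperateGrowth hL (𝓕⁻ H)
  have hf : (f : E → ℂ) = fun x => 𝓕⁻ (H : F → ℂ) (L x) := by
    ext x
    simp [f, SchwartzMap.fourierInv_coe]
  have hconv (φ : 𝓢(E, ℂ)) (x : E) :
      SchwartzMap.convolution (ContinuousLinearMap.mul ℂ ℂ) (𝓕⁻ φ) f x
        = ∫ Ξ, wave x (T Ξ) * (φ (T Ξ) * H Ξ) := by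
    rw [SchwartzMap.convolution_apply, convolution_def]
    have := convolution_fourierInv_comp L T hT hLT (𝓕⁻ φ) H x
    rw [← SchwartzMap.fourier_coe, FourierTransform.fourier_fourierInv_eq] at this
    simpa [hf] using this
  have hfour (φ : 𝓢(E, ℂ)) (ξ : E) :
      𝓕 (SchwartzMap.convolution (ContinuousLinearMap.mul ℂ ℂ) (𝓕⁻ φ) f) ξ = φ ξ * 𝓕 f ξ := by
    rw [SchwartzMap.fourier_convolution]
    simp
  -- The multiplier `χ` fixes `f`, so `m` can be replaced by the Schwartz symbol `κ` without
  -- computing `𝓕 f`, which would be an integral over the fibres of `T`.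
  have hχf : SchwartzMap.convolution (ContinuousLinearMap.mul ℂ ℂ) (𝓕⁻ χ) f = f := by
    ext x
    rw [hconv, hf]
    simp only []
    rw [fourierInv_eq_wave]
    refine integral_congr_ae (.of_forall fun Ξ => ?_)
    have : wave (L x) Ξ = wave x (T Ξ) := by simp only [wave, hLT]
    by_cases h : H Ξ = 0
    · simp [h]
    · simp [this, hχ Ξ h]
  have hmf (ξ : E) : m ((2 * Real.pi) • ξ) * 𝓕 f ξ
      = 𝓕 (SchwartzMap.convolution (ContinuousLinearMap.mul ℂ ℂ) (𝓕⁻ κ) f) ξ := by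
    rw [hfour, hκ, mul_assoc, ← hfour χ, hχf]
  rw [multiplier, ← hf]
  simp_rw [← SchwartzMap.fourier_coe, hmf]
  rw [← SchwartzMap.fourierInv_coe, FourierTransform.fourierInv_fourier_eq, hconv]
  refine integral_congr_ae (.of_forall fun Ξ => ?_)
  by_cases h : H Ξ = 0
  · simp [h]
  · simp [hκ, hχ Ξ h]

end Transfer

/-! ### Comparison of the mixed norm with `L^r` -/

/-- Hölder's inequality on a set `S` of finite measure; on any set if the exponents agree. -/
theorem exists_eLpNorm_restrict_le {D : Type*} [MeasurableSpace D] (μ : Measure D) (S : Set D)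
    {r p : ℝ≥0∞} (hrp : r ≤ p) (h : r = p ∨ μ S ≠ ∞) (hr : r ≠ 0) :
    ∃ K : ℝ≥0, ∀ {ε : Type} [TopologicalSpace ε] [ContinuousENorm ε] (f : D → ε),
      AEStronglyMeasurable f (μ.restrict S) → eLpNorm f r (μ.restrict S) ≤ K * eLpNorm f p μ := by
  rcases h with rfl | hS
  · exact ⟨1, fun f _ => by simpa using eLpNorm_mono_measure f Measure.restrict_le_self⟩
  · have hexp : 0 ≤ 1 / r.toReal - 1 / p.toReal := by
      rcases eq_or_ne p ∞ with rfl | hp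
      · simp
      · have : 0 < r.toReal := ENNReal.toReal_pos hr (ne_top_of_le_ne_top hp hrp)
        have := one_div_le_one_div_of_le this (ENNReal.toReal_mono hp hrp)
        linarith
    have hfin : μ S ^ (1 / r.toReal - 1 / p.toReal) ≠ ∞ := ENNReal.rpow_ne_top_of_nonneg hexp hS
    refine ⟨(μ S ^ (1 / r.toReal - 1 / p.toReal)).toNNReal, fun f hf => ?_⟩
    rw [ENNReal.coe_toNNReal hfin, mul_comm]
    refine (eLpNorm_le_eLpNorm_mul_rpow_measure_univ hrp hf).trans ?_
    rw [Measure.restrict_apply_univ]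
    exact mul_le_mul_left (eLpNorm_mono_measure f Measure.restrict_le_self) _

/-- The mixed norm controls the `L^r` norm on a product set, where each factor has finite measure
unless the corresponding exponent is `r`. -/
theorem exists_lintegral_le_mixedNorm {n : ℕ} {p q r : ℝ≥0∞} (hr : r ≠ 0) (hr' : r ≠ ∞)
    (hrp : r ≤ p) (hrq : r ≤ q) (S : Set ℝ) (X : Set (Space n))
    (hS : r = p ∨ volume S ≠ ∞) (hX : r = q ∨ volume X ≠ ∞) :
    ∃ K : ℝ≥0∞, K ≠ ∞ ∧ ∀ u : ℝ → Space n → ℂ, Measurable (Function.uncurry u) →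
      ∫⁻ z in S ×ˢ X, ‖Function.uncurry u z‖ₑ ^ r.toReal ≤ K * mixedNorm p q u ^ r.toReal := by
  obtain ⟨K₁, h₁⟩ := exists_eLpNorm_restrict_le volume S hrp hS hr
  obtain ⟨K₂, h₂⟩ := exists_eLpNorm_restrict_le volume X hrq hX hr
  have hr0 : 0 < r.toReal := ENNReal.toReal_pos hr hr'
  refine ⟨(K₁ * K₂ : ℝ≥0∞) ^ r.toReal, by finiteness, fun u hu => ?_⟩
  let g : ℝ → ℝ≥0∞ := fun t => eLpNorm (u t) r (volume.restrict X)
  have hg' (t : ℝ) : g t = (∫⁻ x in X, ‖Function.uncurry u (t, x)‖ₑ ^ r.toReal) ^ (1 / r.toReal) :=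
    eLpNorm_eq_lintegral_rpow_enorm_toReal hr hr'
  have hm : Measurable fun z => ‖Function.uncurry u z‖ₑ ^ r.toReal := by fun_prop
  have hg : Measurable g := by
    have : g = fun t => (∫⁻ x in X, ‖Function.uncurry u (t, x)‖ₑ ^ r.toReal) ^ (1 / r.toReal) :=
      funext hg'
    rw [this]
    exact hm.lintegral_prod_right'.pow_const _
  have hle : eLpNorm g r (volume.restrict S) ≤ K₁ * K₂ * mixedNorm p q u := by
    refine (h₁ g hg.aestronglyMeasurable).trans ?_
    rw [mul_assoc]
    refine mul_le_mul_right ?_ _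
    refine eLpNorm_le_nnreal_smul_eLpNorm_of_ae_le_mul' (c := K₂) (.of_forall fun t => ?_) p
    exact h₂ (u t) (hu.comp measurable_prodMk_left).aestronglyMeasurable
  calc ∫⁻ z in S ×ˢ X, ‖Function.uncurry u z‖ₑ ^ r.toReal
      = ∫⁻ t in S, ∫⁻ x in X, ‖Function.uncurry u (t, x)‖ₑ ^ r.toReal :=
        setLIntegral_prod _ hm.aemeasurable
    _ = ∫⁻ t in S, ‖g t‖ₑ ^ r.toReal := by
      refine lintegral_congr fun t => ?_
      rw [enorm_eq_self, hg', ← ENNReal.rpow_mul, one_div, inv_mul_cancel₀ hr0.ne',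
        ENNReal.rpow_one]
    _ = eLpNorm g r (volume.restrict S) ^ r.toReal := by
      rw [eLpNorm_eq_lintegral_rpow_enorm_toReal hr hr', ← ENNReal.rpow_mul, one_div,
        inv_mul_cancel₀ hr0.ne', ENNReal.rpow_one]
    _ ≤ (K₁ * K₂ * mixedNorm p q u) ^ r.toReal := ENNReal.rpow_le_rpow hle hr0.le
    _ = _ := ENNReal.mul_rpow_of_nonneg _ _ hr0.le

variable {n : ℕ}

/-! ### The collapsed solution as an oscillatory integral -/

/-- The diagonal embedding as a continuous linear map. -/
def diagL (n : ℕ) : Space n →L[ℝ] Space3 n :=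
  (PiLp.continuousLinearEquiv 2 ℝ (fun _ : Fin 3 => Space n)).symm.toContinuousLinearMap.comp
    (ContinuousLinearMap.pi fun _ => ContinuousLinearMap.id ℝ (Space n))

theorem diagL_apply (x : Space n) : diagL n x = diag x := rfl

/-- The sum of the frequencies, which is dual to the diagonal embedding. -/
def freqSum (Ξ : Space3 n) : Space n := Ξ 0 + Ξ 1 + Ξ 2

theorem contDiff_component (i : Fin 3) : ContDiff ℝ (⊤ : ℕ∞) fun Ξ : Space3 n => Ξ i :=
  (PiLp.proj 2 (fun _ : Fin 3 => Space n) i : Space3 n →L[ℝ] Space n).contDiff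

theorem contDiff_freqSum : ContDiff ℝ (⊤ : ℕ∞) (freqSum : Space3 n → Space n) :=
  ((contDiff_component 0).add (contDiff_component 1)).add (contDiff_component 2)

theorem inner_diag (x : Space n) (Ξ : Space3 n) :
    inner ℝ (diag x) Ξ = inner ℝ x (freqSum Ξ) := by
  simp [PiLp.inner_apply, Fin.sum_univ_three, diag, freqSum, inner_add_right]

/-- Ensures that a Schwartz function restricted to the diagonal is again Schwartz. -/
theorem antilipschitz_diag : AntilipschitzWith 1 (diagL n) := by
  refine AddMonoidHomClass.antilipschitz_of_bound _ fun x => ?_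
  have h := PiLp.norm_apply_le (diag x) 0
  simpa [diagL_apply, diag] using h

/-- The dispersion relation `(|ξ|² + |η|² - |ζ|²) / 2` in terms of ordinary frequencies. -/
def dispersion (Ξ : Space3 n) : ℝ :=
  (‖((2 * Real.pi) • Ξ) 0‖ ^ 2 + ‖((2 * Real.pi) • Ξ) 1‖ ^ 2 - ‖((2 * Real.pi) • Ξ) 2‖ ^ 2) / 2

theorem contDiff_dispersion : ContDiff ℝ (⊤ : ℕ∞) (dispersion : Space3 n → ℝ) := by
  have h (i : Fin 3) : ContDiff ℝ (⊤ : ℕ∞) fun Ξ : Space3 n => ‖((2 * Real.pi) • Ξ) i‖ ^ 2 :=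
    ((contDiff_component i).comp (contDiff_const_smul _)).norm_sq ℝ
  exact (((h 0).add (h 1)).sub (h 2)).div_const 2

/-- The factor by which the evolution multiplies the Fourier transform. -/
def phase (t : ℝ) (Ξ : Space3 n) : ℂ := Complex.exp (((-(t * dispersion Ξ) : ℝ) : ℂ) * Complex.I)

theorem norm_phase (t : ℝ) (Ξ : Space3 n) : ‖phase t Ξ‖ = 1 := Complex.norm_exp_ofReal_mul_I _

theorem phase_add (t t' : ℝ) (Ξ : Space3 n) : phase (t + t') Ξ = phase t Ξ * phase t' Ξ := by
  simp only [phase, ← Complex.exp_add, ← add_mul, ← Complex.ofReal_add]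
  congr 3
  ring

theorem contDiff_phase (t : ℝ) : ContDiff ℝ (⊤ : ℕ∞) (phase t : Space3 n → ℂ) := by
  have := contDiff_dispersion (n := n)
  unfold phase
  refine Complex.contDiff_exp.comp (ContDiff.mul (Complex.ofRealCLM.contDiff.comp ?_) contDiff_const)
  exact (contDiff_const.mul this).neg

theorem contDiff_wave_freqSum (a : Space n) :
    ContDiff ℝ (⊤ : ℕ∞) fun Ξ : Space3 n => wave a (freqSum Ξ) := by
  have := contDiff_freqSum (n := n)
  unfold wave
  refine Complex.contDiff_exp.comp (ContDiff.mul (Complex.ofRealCLM.contDiff.comp ?_) contDiff_const)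
  exact contDiff_const.mul (contDiff_const.inner ℝ this)

theorem evolution_fourierInv (t : ℝ) (H : 𝓢(Space3 n, ℂ)) :
    evolution t (𝓕⁻ H : 𝓢(Space3 n, ℂ)) = 𝓕⁻ (fun Ξ => phase t Ξ * H Ξ) := by
  unfold evolution multiplier
  rw [← SchwartzMap.fourier_coe, FourierTransform.fourier_fourierInv_eq]
  congr 1
  ext Ξ
  congr 1
  simp only [phase, dispersion]
  congr 1
  push_cast
  ring

/-- The fractional derivative of the collapsed solution as an oscillatory integral, if the datum has
Fourier support away from `ξ + η + ζ = 0`. -/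
theorem fracDeriv_evolution (α t : ℝ) {e : Space n} (χ : ContDiffBump e) (hχ : χ.rOut < ‖e‖)
    (H : 𝓢(Space3 n, ℂ)) (hc : HasCompactSupport H)
    (hH : ∀ Ξ, H Ξ ≠ 0 → freqSum Ξ ∈ Metric.closedBall e χ.rIn) (x : Space n) :
    fracDeriv α (fun x => evolution t (𝓕⁻ H : 𝓢(Space3 n, ℂ)) (diag x)) x
      = ∫ Ξ, wave x (freqSum Ξ)
        * (((‖(2 * Real.pi) • freqSum Ξ‖ ^ α : ℝ) : ℂ) * (phase t Ξ * H Ξ)) := by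
  have hχc : HasCompactSupport fun ξ => ((χ ξ : ℝ) : ℂ) :=
    χ.hasCompactSupport.comp_left (g := ((↑) : ℝ → ℂ)) Complex.ofReal_zero
  have hχs : ContDiff ℝ (⊤ : ℕ∞) fun ξ => ((χ ξ : ℝ) : ℂ) := Complex.ofRealCLM.contDiff.comp χ.contDiff
  have hκs : ContDiff ℝ (⊤ : ℕ∞) fun ξ =>
      ((‖(2 * Real.pi) • ξ‖ ^ α : ℝ) : ℂ) * ((χ ξ : ℝ) : ℂ) := by
    rw [contDiff_iff_contDiffAt]
    intro ξ
    rcases eq_or_ne ξ 0 with rfl | hξ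
    -- The symbol may be singular only at the origin, and there the cutoff vanishes because `χ.rOut
    -- < ‖e‖`.
    · have h0 : (fun ξ => ((‖(2 * Real.pi) • ξ‖ ^ α : ℝ) : ℂ) * ((χ ξ : ℝ) : ℂ))
          =ᶠ[nhds 0] fun _ => 0 := by
        have hopen : IsOpen (Metric.closedBall e χ.rOut)ᶜ := Metric.isClosed_closedBall.isOpen_compl
        filter_upwards [hopen.mem_nhds (x := 0) (by simpa using hχ)] with ξ hξ
        rw [χ.zero_of_le_dist (by simpa using (not_le.1 (fun h => hξ h)).le)]
        simp
      exact contDiffAt_const.congr_of_eventuallyEq h0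
    · refine ContDiffAt.mul (Complex.ofRealCLM.contDiff.contDiffAt.comp ξ ?_) hχs.contDiffAt
      have h2 : (2 * Real.pi) • ξ ≠ 0 := smul_ne_zero (by positivity) hξ
      refine ContDiffAt.rpow_const_of_ne (ContDiffAt.norm ℝ ?_ h2) (norm_ne_zero_iff.2 h2)
      fun_prop
  have hHs : ContDiff ℝ (⊤ : ℕ∞) fun Ξ => phase t Ξ * H Ξ := (contDiff_phase t).mul (H.smooth ⊤)
  let H' : 𝓢(Space3 n, ℂ) := hc.mul_left.toSchwartzMap hHs
  have hm := multiplier_fourierInv_comp (diagL n) antilipschitz_diag freqSum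
    contDiff_freqSum.continuous inner_diag H' (fun ξ => ((‖ξ‖ ^ α : ℝ) : ℂ))
    (hχc.toSchwartzMap hχs) (hχc.mul_left.toSchwartzMap hκs)
    (fun Ξ hΞ => ?_) (fun ξ => rfl) x
  · rw [fracDeriv]
    simp_rw [evolution_fourierInv]
    exact hm
  · have h1 : χ (freqSum Ξ) = 1 := χ.one_of_mem_closedBall (hH Ξ (right_ne_zero_of_mul hΞ))
    simp [h1]

/-- The collapsed solution, with the fractional derivative applied, as an oscillatory integral for
the datum with Fourier transform `Ψ`. -/
def collapsedWave (α : ℝ) (Ψ : Space3 n → ℂ) (z : ℝ × Space n) : ℂ :=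
  ∫ Ξ, wave z.2 (freqSum Ξ)
    * (((‖(2 * Real.pi) • freqSum Ξ‖ ^ α : ℝ) : ℂ) * (phase z.1 Ξ * Ψ Ξ))

@[fun_prop]
theorem continuous_freqSum : Continuous (freqSum : Space3 n → Space n) := contDiff_freqSum.continuous

@[fun_prop]
theorem continuous_phase : Continuous fun p : ℝ × Space3 n => phase p.1 p.2 := by
  have := (contDiff_dispersion (n := n)).continuous
  unfold phase
  fun_prop

theorem continuous_symbol {α : ℝ} (hα : 0 ≤ α) :
    Continuous fun Ξ : Space3 n => ((‖(2 * Real.pi) • freqSum Ξ‖ ^ α : ℝ) : ℂ) := by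
  refine Complex.continuous_ofReal.comp ((Real.continuous_rpow_const hα).comp ?_)
  fun_prop

theorem continuous_integrand {α : ℝ} (hα : 0 ≤ α) {Ψ : Space3 n → ℂ} (hΨ : Continuous Ψ) :
    Continuous fun p : (ℝ × Space n) × Space3 n => wave p.1.2 (freqSum p.2)
      * (((‖(2 * Real.pi) • freqSum p.2‖ ^ α : ℝ) : ℂ) * (phase p.1.1 p.2 * Ψ p.2)) := by
  have h1 : Continuous fun p : (ℝ × Space n) × Space3 n => wave p.1.2 (freqSum p.2) :=
    continuous_wave.comp (f := fun p : (ℝ × Space n) × Space3 n => (p.1.2, freqSum p.2))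
      (by fun_prop)
  have h2 : Continuous fun p : (ℝ × Space n) × Space3 n => phase p.1.1 p.2 :=
    continuous_phase.comp (f := fun p : (ℝ × Space n) × Space3 n => (p.1.1, p.2)) (by fun_prop)
  exact h1.mul (((continuous_symbol hα).comp continuous_snd).mul (h2.mul (hΨ.comp continuous_snd)))

theorem integrable_integrand {α : ℝ} (hα : 0 ≤ α) {Ψ : Space3 n → ℂ} (hΨ : Continuous Ψ)
    (hc : HasCompactSupport Ψ) (z : ℝ × Space n) :
    Integrable fun Ξ => wave z.2 (freqSum Ξ)
      * (((‖(2 * Real.pi) • freqSum Ξ‖ ^ α : ℝ) : ℂ) * (phase z.1 Ξ * Ψ Ξ)) :=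
  ((continuous_integrand hα hΨ).comp (Continuous.prodMk_right z)).integrable_of_hasCompactSupport
    hc.mul_left.mul_left.mul_left

theorem continuous_collapsedWave {α : ℝ} (hα : 0 ≤ α) {Ψ : Space3 n → ℂ} (hΨ : Continuous Ψ)
    (hc : HasCompactSupport Ψ) : Continuous (collapsedWave α Ψ) := by
  unfold collapsedWave
  refine continuous_of_dominated
    (bound := fun Ξ => ‖((‖(2 * Real.pi) • freqSum Ξ‖ ^ α : ℝ) : ℂ) * Ψ Ξ‖)
    (fun z => (integrable_integrand hα hΨ hc z).aestronglyMeasurable)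
    (fun z => .of_forall fun Ξ => ?_) ?_ (.of_forall fun Ξ => ?_)
  · simp only [norm_mul, norm_wave, norm_phase, one_mul, le_refl]
  · have h : Continuous fun Ξ => ((‖(2 * Real.pi) • freqSum Ξ‖ ^ α : ℝ) : ℂ) * Ψ Ξ :=
      (continuous_symbol hα).mul hΨ
    have h' := h.integrable_of_hasCompactSupport (μ := volume) hc.mul_left
    exact h'.norm
  · have h : Continuous fun z : ℝ × Space n => (z, Ξ) := by fun_prop
    have h' := (continuous_integrand hα hΨ).comp h
    simpa only [Function.comp_def] using h'

/-- At the space-time origin both exponentials equal `1`, so a nonnegative integrand remains,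
positive at `c`. -/
theorem collapsedWave_zero_ne_zero {α : ℝ} (hα : 0 ≤ α) {c : Space3 n} (ψ : ContDiffBump c)
    (hc : freqSum c ≠ 0) : collapsedWave α (fun Ξ => ((ψ Ξ : ℝ) : ℂ)) 0 ≠ 0 := by
  have hpos : 0 < ∫ Ξ : Space3 n, ‖(2 * Real.pi) • freqSum Ξ‖ ^ α * ψ Ξ := by
    refine Continuous.integral_pos_of_hasCompactSupport_nonneg_nonzero (x := c) ?_
      ψ.hasCompactSupport.mul_left (fun Ξ => mul_nonneg (by positivity) ψ.nonneg) ?_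
    · refine Continuous.mul ((Real.continuous_rpow_const hα).comp ?_) ψ.continuous
      fun_prop
    · have h1 : ψ c = 1 := ψ.one_of_mem_closedBall (Metric.mem_closedBall_self ψ.rIn_pos.le)
      have h2 : (2 * Real.pi) • freqSum c ≠ 0 := smul_ne_zero (by positivity) hc
      have h3 : 0 < ‖(2 * Real.pi) • freqSum c‖ := norm_pos_iff.2 h2
      rw [h1]
      positivity
  have : collapsedWave α (fun Ξ => ((ψ Ξ : ℝ) : ℂ)) 0
      = ((∫ Ξ : Space3 n, ‖(2 * Real.pi) • freqSum Ξ‖ ^ α * ψ Ξ : ℝ) : ℂ) := by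
    rw [← integral_complex_ofReal]
    simp [collapsedWave, wave, phase]
  rw [this]
  exact_mod_cast hpos.ne'

/-! ### Translates of the datum and their Sobolev norms -/

/-- The Fourier side of the translation by `(τ, a)` in space-time. -/
def translationSymbol (z : ℝ × Space n) (Ξ : Space3 n) : ℂ :=
  phase (-z.1) Ξ * wave (-z.2) (freqSum Ξ)

theorem norm_translationSymbol (z : ℝ × Space n) (Ξ : Space3 n) : ‖translationSymbol z Ξ‖ = 1 := by
  simp [translationSymbol, norm_phase, norm_wave]

theorem contDiff_translationSymbol (z : ℝ × Space n) :
    ContDiff ℝ (⊤ : ℕ∞) (translationSymbol z) :=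
  (contDiff_phase _).mul (contDiff_wave_freqSum _)

theorem contDiff_signSum {N : ℕ} (ε : Fin N → ℤˣ) (z : Fin N → ℝ × Space n) :
    ContDiff ℝ (⊤ : ℕ∞) fun Ξ => signSum ε fun j => translationSymbol (z j) Ξ := by
  unfold signSum
  exact ContDiff.sum fun j _ => contDiff_const.mul (contDiff_translationSymbol (z j))

/-- `phase` and `wave` are multiplicative in time and position, so each `translationSymbol` shifts
the argument of the solution. -/
theorem collapsedWave_signSum {α : ℝ} (hα : 0 ≤ α) {Ψ : Space3 n → ℂ} (hΨ : Continuous Ψ)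
    (hc : HasCompactSupport Ψ) {N : ℕ} (ε : Fin N → ℤˣ) (w : Fin N → ℝ × Space n)
    (z : ℝ × Space n) :
    collapsedWave α (fun Ξ => (signSum ε fun j => translationSymbol (w j) Ξ) * Ψ Ξ) z
      = signSum ε fun j => collapsedWave α Ψ (z - w j) := by
  simp only [collapsedWave, signSum]
  simp_rw [← integral_const_mul]
  rw [← integral_finsetSum _ fun j _ => (integrable_integrand hα hΨ hc _).const_mul _]
  refine integral_congr_ae (.of_forall fun Ξ => ?_)
  simp only [Finset.sum_mul, Finset.mul_sum]
  refine Finset.sum_congr rfl fun j _ => ?_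
  simp only [translationSymbol, Prod.fst_sub, Prod.snd_sub, wave_sub z.2, sub_eq_add_neg z.1,
    phase_add]
  ring

/-- The weight of the Sobolev norm. -/
def sobolevWeight (s : ℝ) (Ξ : Space3 n) : ℂ := (((1 + ‖(2 * Real.pi) • Ξ‖ ^ 2) ^ (s / 2) : ℝ) : ℂ)

theorem continuous_sobolevWeight (s : ℝ) : Continuous (sobolevWeight s : Space3 n → ℂ) := by
  refine Complex.continuous_ofReal.comp (Continuous.rpow_const (by fun_prop) fun Ξ => Or.inl ?_)
  positivity

theorem sobolevNorm_fourierInv_sq (s : ℝ) (H : 𝓢(Space3 n, ℂ)) :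
    sobolevNorm s (𝓕⁻ H : 𝓢(Space3 n, ℂ)) ^ 2 = ∫⁻ Ξ, ‖sobolevWeight s Ξ * H Ξ‖ₑ ^ 2 := by
  rw [sobolevNorm, ← SchwartzMap.fourier_coe, FourierTransform.fourier_fourierInv_eq,
    eLpNorm_eq_lintegral_rpow_enorm_toReal two_ne_zero ENNReal.ofNat_ne_top,
    ← ENNReal.rpow_natCast, ← ENNReal.rpow_mul]
  simp [sobolevWeight]

theorem lintegral_sobolevWeight_lt_top (s : ℝ) {Ψ : Space3 n → ℂ} (hΨ : Continuous Ψ)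
    (hc : HasCompactSupport Ψ) : ∫⁻ Ξ, ‖sobolevWeight s Ξ * Ψ Ξ‖ₑ ^ 2 < ∞ := by
  have h := (((continuous_sobolevWeight s).mul hΨ).memLp_of_hasCompactSupport (p := 2)
    (μ := volume) hc.mul_left).eLpNorm_lt_top
  rw [eLpNorm_lt_top_iff_lintegral_rpow_enorm_lt_top two_ne_zero ENNReal.ofNat_ne_top] at h
  simpa using h

/-- Orthogonality of the signs is applied at each frequency, where all `N` symbols have modulus one.
-/
theorem sum_signs_lintegral {s : ℝ} {Ψ : Space3 n → ℂ} (hΨ : Continuous Ψ) {N : ℕ}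
    (w : Fin N → ℝ × Space n) :
    ∑ ε : Fin N → ℤˣ, ∫⁻ Ξ, ‖sobolevWeight s Ξ
        * ((signSum ε fun j => translationSymbol (w j) Ξ) * Ψ Ξ)‖ₑ ^ 2
      = 2 ^ N * (N * ∫⁻ Ξ, ‖sobolevWeight s Ξ * Ψ Ξ‖ₑ ^ 2) := by
  have hw := continuous_sobolevWeight (n := n) s
  have hm (ε : Fin N → ℤˣ) : Measurable fun Ξ => ‖sobolevWeight s Ξ
      * ((signSum ε fun j => translationSymbol (w j) Ξ) * Ψ Ξ)‖ₑ ^ 2 :=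
    (hw.mul ((contDiff_signSum ε w).continuous.mul hΨ)).measurable.enorm.pow_const 2
  have hm' : Measurable fun Ξ => ‖sobolevWeight s Ξ * Ψ Ξ‖ₑ ^ 2 :=
    (hw.mul hΨ).measurable.enorm.pow_const 2
  rw [← lintegral_finsetSum _ fun ε _ => hm ε, ← mul_assoc, ← lintegral_const_mul _ hm']
  refine lintegral_congr fun Ξ => ?_
  simp_rw [enorm_mul, mul_pow]
  rw [← Finset.mul_sum, ← Finset.sum_mul, sum_signs_enorm_sq]
  have h1 (j : Fin N) : ‖translationSymbol (w j) Ξ‖ₑ = 1 := by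
    rw [← ofReal_norm, norm_translationSymbol, ENNReal.ofReal_one]
  simp [h1]
  ring

/-! ### Choice of translates and cutoffs, and the conclusion -/

/-- A ball of radius `δ`, together with disjoint translates in the time or in a space direction,
in which the directions other than the one of the translation remain bounded if required. -/
theorem exists_translates (hn : 1 ≤ n) {p q r : ℝ≥0∞} (h : r = p ∨ r = q) (δ : ℝ) :
    ∃ (S : Set ℝ) (X : Set (Space n)) (d : ℝ × Space n),
      (r = p ∨ volume S ≠ ∞) ∧ (r = q ∨ volume X ≠ ∞) ∧ MeasurableSet S ∧ MeasurableSet X ∧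
      2 * δ ≤ ‖d‖ ∧ ∀ j : ℕ, Metric.ball (j • d) δ ⊆ S ×ˢ X := by
  rcases h with h | h
  · refine ⟨Set.univ, Metric.ball 0 δ, (2 * δ, 0), Or.inl h, Or.inr measure_ball_lt_top.ne,
      .univ, measurableSet_ball, ?_, fun j z hz => ?_⟩
    · rw [Prod.norm_mk]
      exact le_max_of_le_left (le_abs_self _)
    -- The product carries the sup metric, so its balls are products of balls.
    · rw [← ball_prod_same] at hz
      simpa using hz.2
  · refine ⟨Metric.ball 0 δ, Set.univ, (0, EuclideanSpace.single ⟨0, hn⟩ (2 * δ)),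
      Or.inr measure_ball_lt_top.ne, Or.inl h, measurableSet_ball, .univ, ?_, fun j z hz => ?_⟩
    · rw [Prod.norm_mk]
      refine le_max_of_le_right ?_
      simp [le_abs_self]
    · rw [← ball_prod_same] at hz
      simpa using hz.1

/-- The cutoffs on the two sides of the duality: a datum that is concentrated at a frequency whose
components have a nonzero sum. -/
theorem exists_cutoffs (hn : 1 ≤ n) :
    ∃ (e : Space n) (χ : ContDiffBump e) (c : Space3 n) (ψ : ContDiffBump c), χ.rOut < ‖e‖ ∧
      freqSum c ≠ 0 ∧ ∀ Ξ, ψ Ξ ≠ 0 → freqSum Ξ ∈ Metric.closedBall e χ.rIn := by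
  let e : Space n := EuclideanSpace.single ⟨0, hn⟩ 1
  let c : Space3 n := WithLp.toLp 2 ![e, 0, 0]
  have he : ‖e‖ = 1 := by simp [e]
  have hc : freqSum c = e := by simp [freqSum, c]
  -- Any outer radius below `‖e‖ = 1` keeps the cutoff away from the origin.
  let χ : ContDiffBump e := ⟨1 / 4, 1 / 2, by norm_num, by norm_num⟩
  have hnhds : freqSum ⁻¹' Metric.closedBall e χ.rIn ∈ nhds c := by
    refine continuous_freqSum.continuousAt.preimage_mem_nhds ?_
    rw [hc]
    exact Metric.closedBall_mem_nhds e χ.rIn_pos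
  obtain ⟨ρ, hρ, hsub⟩ := Metric.mem_nhds_iff.1 hnhds
  let ψ : ContDiffBump c := ⟨ρ / 2, ρ, by positivity, by linarith⟩
  refine ⟨e, χ, c, ψ, ?_, ?_, fun Ξ hΞ => hsub ?_⟩
  · rw [he]; norm_num [χ]
  · rw [hc, ← norm_ne_zero_iff, he]; exact one_ne_zero
  · have : Ξ ∈ Function.support ψ := hΞ
    rwa [ψ.support_eq] at this

/-- The smaller of the two exponents of a collapsing estimate is at least `2`. -/
theorem two_le_of_collapsingEstimate (hn : 1 ≤ n) {p q r : ℝ≥0∞} {α s : ℝ} (hα : 0 ≤ α)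
    (h : CollapsingEstimate n p q α s) (hr : r ≠ 0) (hr' : r ≠ ∞) (hrp : r ≤ p) (hrq : r ≤ q)
    (hrpq : r = p ∨ r = q) : 2 ≤ r.toReal := by
  obtain ⟨C, hC⟩ := h
  obtain ⟨e, χ, c, ψ, hχ, hfc, hψ⟩ := exists_cutoffs hn
  let Ψ : Space3 n → ℂ := fun Ξ => ((ψ Ξ : ℝ) : ℂ)
  have hΨ : ContDiff ℝ (⊤ : ℕ∞) Ψ := Complex.ofRealCLM.contDiff.comp ψ.contDiff
  have hΨc : HasCompactSupport Ψ :=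
    ψ.hasCompactSupport.comp_left (g := ((↑) : ℝ → ℂ)) Complex.ofReal_zero
  have hV := continuous_collapsedWave hα hΨ.continuous hΨc
  have hV0 : collapsedWave α Ψ 0 ≠ 0 := collapsedWave_zero_ne_zero hα ψ hfc
  -- By continuity `V` keeps half its size on a ball, which gives every translate the same lower
  -- bound for its mass.
  obtain ⟨δ, hδ, hball⟩ : ∃ δ > 0, ∀ z ∈ Metric.ball (0 : ℝ × Space n) δ,
      ‖collapsedWave α Ψ 0‖ / 2 < ‖collapsedWave α Ψ z‖ := by
    refine Metric.mem_nhds_iff.1 (hV.norm.continuousAt.eventually_const_lt ?_)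
    exact half_lt_self (norm_pos_iff.2 hV0)
  obtain ⟨S, X, d, hS, hX, hSm, hXm, hd, hsub⟩ := exists_translates hn hrpq δ
  obtain ⟨K, hK, hmixed⟩ := exists_lintegral_le_mixedNorm hr hr' hrp hrq S X hS hX
  have hr0 : 0 < r.toReal := ENNReal.toReal_pos hr hr'
  have hsmooth (N : ℕ) (ε : Fin N → ℤˣ) : ContDiff ℝ (⊤ : ℕ∞) fun Ξ =>
      (signSum ε fun j : Fin N => translationSymbol ((j : ℕ) • d) Ξ) * Ψ Ξ :=
    (contDiff_signSum ε _).mul hΨ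
  let H (N : ℕ) (ε : Fin N → ℤˣ) : 𝓢(Space3 n, ℂ) := hΨc.mul_left.toSchwartzMap (hsmooth N ε)
  have hH (N : ℕ) (ε : Fin N → ℤˣ) (Ξ : Space3 n) : H N ε Ξ
      = (signSum ε fun j : Fin N => translationSymbol ((j : ℕ) • d) Ξ) * Ψ Ξ := rfl
  have hsol (N : ℕ) (ε : Fin N → ℤˣ) (z : ℝ × Space n) :
      Function.uncurry (fun t => fracDeriv α fun x =>
        evolution t (𝓕⁻ (H N ε) : 𝓢(Space3 n, ℂ)) (diag x)) z
        = signSum ε fun j : Fin N => collapsedWave α Ψ (z - (j : ℕ) • d) := by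
    rw [← collapsedWave_signSum hα hΨ.continuous hΨc ε, Function.uncurry_def]
    refine fracDeriv_evolution α z.1 χ hχ (H N ε) hΨc.mul_left (fun Ξ hΞ => hψ Ξ ?_) z.2
    have := right_ne_zero_of_mul hΞ
    simpa [Ψ] using this
  have hcont (j : ℕ) : Continuous fun z => collapsedWave α Ψ (z - j • d) :=
    hV.comp (continuous_id.sub continuous_const)
  refine two_le_of_signSum_bound (volume.restrict (S ×ˢ X)) hr0
    (fun j z => collapsedWave α Ψ (z - j • d)) (fun j => (hcont j).measurable)
    (fun j => Metric.ball (j • d) δ) (fun j => measurableSet_ball) ?_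
    (c := ENNReal.ofReal (‖collapsedWave α Ψ 0‖ / 2) ^ r.toReal
      * volume (Metric.ball (0 : ℝ × Space n) δ))
    (A := ∫⁻ Ξ, ‖sobolevWeight s Ξ * Ψ Ξ‖ₑ ^ 2) (K := K * (C : ℝ≥0∞) ^ r.toReal) ?_
    (lintegral_sobolevWeight_lt_top s hΨ.continuous hΨc).ne (by finiteness) ?_
    (fun N ε => sobolevNorm s (𝓕⁻ (H N ε) : 𝓢(Space3 n, ℂ))) ?_ ?_
  · intro i j hij
    refine Metric.ball_disjoint_ball ?_
    -- The centres differ by a nonzero integer multiple of `d`, and `‖d‖ ≥ 2 * δ`.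
    rw [dist_eq_norm, ← natCast_zsmul, ← natCast_zsmul, ← sub_smul, ← two_mul]
    refine hd.trans ?_
    rw [← Int.cast_smul_eq_zsmul ℝ, norm_smul]
    refine le_mul_of_one_le_left (norm_nonneg _) ?_
    rw [Real.norm_eq_abs, ← Int.cast_abs]
    exact_mod_cast Int.one_le_abs (sub_ne_zero.2 (Nat.cast_injective.ne hij))
  · refine mul_ne_zero ?_ (Metric.measure_ball_pos volume _ hδ).ne'
    rw [Ne, ENNReal.rpow_eq_zero_iff_of_pos hr0, ENNReal.ofReal_eq_zero, not_le]
    exact half_pos (norm_pos_iff.2 hV0)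
  · intro j
    have : (volume : Measure (ℝ × Space n)).IsAddHaarMeasure :=
      inferInstanceAs ((volume : Measure ℝ).prod (volume : Measure (Space n))).IsAddHaarMeasure
    rw [Measure.restrict_restrict_of_subset (hsub j), ← Measure.addHaar_ball_center volume (j • d) δ,
      ← setLIntegral_const]
    refine setLIntegral_mono' measurableSet_ball fun z hz => ENNReal.rpow_le_rpow ?_ hr0.le
    rw [← ofReal_norm]
    refine ENNReal.ofReal_le_ofReal (hball _ ?_).le
    rwa [mem_ball_zero_iff, ← dist_eq_norm]
  · intro N
    simp_rw [sobolevNorm_fourierInv_sq, hH]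
    exact (sum_signs_lintegral hΨ.continuous fun j : Fin N => (j : ℕ) • d).le
  · intro N ε
    simp_rw [← hsol N ε]
    refine (hmixed _ ?_).trans ?_
    · rw [funext (hsol N ε)]
      unfold signSum
      exact Finset.measurable_fun_sum _ fun j _ => (hcont j).measurable.const_mul _
    · rw [mul_assoc, ← ENNReal.mul_rpow_of_nonneg _ _ hr0.le]
      gcongr
      exact hC _

end Collapsing

end

theorem theorem3 (n : ℕ) (hn : 1 ≤ n) (p q : ENNReal) (hp : 0 < p) (hq : 0 < q)
    (α s : ℝ) (hα : 0 ≤ α) (hs : 0 ≤ s)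
    (h : Collapsing.CollapsingEstimate n p q α s) :
    2 ≤ p ∧ 2 ≤ q := by
  -- If the smaller exponent is below `2`, it is finite, so the bound on its `toReal` gives the
  -- contradiction.
  rw [← le_inf_iff]
  by_contra! hlt
  have hr' : p ⊓ q ≠ ⊤ := (hlt.trans ENNReal.ofNat_lt_top).ne
  have h2 := Collapsing.two_le_of_collapsingEstimate hn hα h (lt_inf_iff.2 ⟨hp, hq⟩).ne' hr'
    inf_le_left inf_le_right (min_choice p q)
  have h3 := (ENNReal.ofReal_le_iff_le_toReal hr').2 h2
  rw [ENNReal.ofReal_ofNat] at h3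
  exact absurd h3 (not_le.2 hlt)
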